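/- A bounded operator on a complex Hilbert space is subnormal if it is the restriction of a normal operator to an invariant subspace. A finite tuple $(S_1,\dots,S_n)$ of bounded operators is (jointly) hyponormal if the operator matrix with $(i,j)$ entry $[S_j^*,S_i]=S_j^*S_i-S_iS_j^*$ is positive. A commuting pair $(T_1,T_2)$ is $2$-hyponormal if $(T_1,T_2,T_1^2,T_2T_1,T_2^2)$ is hyponormal. Let $\mathfrak H_0$ be the class of commuting pairs of subnormal operators, and $\mathfrak H_2$ the class of $2$-hyponormal pairs in $\mathfrak H_0$. Let $0<a\le\sqrt{1/2}$. For $0<\kappa<1$ put $x_0=\kappa\sqrt{3/4}$ and $x_n=\frac{\sqrt{(n+1)(n+3)}}{n+2}$ for $n\ge 1$. Let $W=(T_1,T_2)$ be the $2$-variable weighted shift on $\ell^2(\mathbb Z_+^2)$, $T_1e_{\mathbf k}=\alpha_{\mathbf k}e_{\mathbf k+(1,0)}$ and $T_2e_{\mathbf k}=\beta_{\mathbf k}e_{\mathbf k+(0,1)}$, whose weights are $$\alpha_{(k_1,0)}=x_{k_1},\qquad \alpha_{(0,k_2)}=a\ (k_2\ge1),\qquad \alpha_{(k_1,k_2)}=1\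 (k_1,k_2\ge1),$$ $$\beta_{(0,0)}=\kappa,\qquad \beta_{(k_1,0)}=\frac{a\kappa}{x_0x_1\cdots x_{k_1-1}}\ (k_1\ge1),\qquad \beta_{(k_1,k_2)}=1\ (k_2\ge1),$$ and let $W^{(2,1)}=(T_1^2,T_2)$. Then, for all such $\kappa$: (i) $W\in\mathfrak H_0$; (ii) $W\in\mathfrak H_2$ if and only if $\kappa\le h_2(a):=\sqrt{\dfrac{9(9-16a^2)}{157-360a^2+144a^4}}$; (iii) $W^{(2,1)}\in\mathfrak H_2$ if and only if $\kappa\le h_2^{(2,1)}(a):=\sqrt{\dfrac{225(15-28a^2)}{6238-15015a^2+6300a^4}}$. Moreover: (iv) $h_2(a)<h_2^{(2,1)}(a)$. -/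

import Mathlib

noncomputable section

/-! ### Operators, subnormality, and joint hyponormality -/

section Operators

universe u

variable {H : Type u} [NormedAddCommGroup H] [InnerProductSpace ℂ H] [CompleteSpace H]

/-- `T` is subnormal: it is (up to an isometric embedding `J : H → K`) the restriction of a normal
operator `N`, acting on a complex Hilbert space `K`, to the invariant subspace `J H`. -/
def IsSubnormal (T : H →L[ℂ] H) : Prop :=
  ∃ (K : Type u) (_ : NormedAddCommGroup K) (_ : InnerProductSpace ℂ K) (_ : CompleteSpace K)
    (J : H →ₗᵢ[ℂ] K) (N : K →L[ℂ] K), IsStarNormal N ∧ ∀ x : H, N (J x) = J (T x)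

/-- The bounded operator on the Hilbert direct sum of copies of `H` indexed by `ι` given by a
finite operator matrix: `(A x)_i = ∑ j, A i j (x_j)`. -/
def operatorMatrix {ι : Type*} [Fintype ι] (A : ι → ι → (H →L[ℂ] H)) :
    PiLp 2 (fun _ : ι => H) →L[ℂ] PiLp 2 (fun _ : ι => H) :=
  ((PiLp.continuousLinearEquiv 2 ℂ (fun _ : ι => H)).symm :
      (∀ _ : ι, H) →L[ℂ] PiLp 2 (fun _ : ι => H)) ∘L
    ContinuousLinearMap.pi fun i => ∑ j, A i j ∘L PiLp.proj 2 (fun _ : ι => H) j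

theorem operatorMatrix_apply {ι : Type*} [Fintype ι] (A : ι → ι → (H →L[ℂ] H))
    (x : PiLp 2 (fun _ : ι => H)) (i : ι) : operatorMatrix A x i = ∑ j, A i j (x j) := by
  simp [operatorMatrix]

/-- The tuple `T` is (jointly) hyponormal: the operator matrix whose `(i, j)` entry is the
commutator `[T_j^*, T_i] = T_j^* T_i - T_i T_j^*` is positive. -/
def IsJointlyHyponormal {ι : Type*} [Fintype ι] (T : ι → (H →L[ℂ] H)) : Prop :=
  (operatorMatrix fun i j =>
    ContinuousLinearMap.adjoint (T j) * T i - T i * ContinuousLinearMap.adjoint (T j)).IsPositive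

/-- The exponents `(p, q)` with `1 ≤ p + q ≤ k`. -/
def pairExponents (k : ℕ) : Finset (ℕ × ℕ) :=
  (Finset.range (k + 1) ×ˢ Finset.range (k + 1)).filter
    fun m => 1 ≤ m.1 + m.2 ∧ m.1 + m.2 ≤ k

/-- A commuting pair `T = (T₁, T₂)` is `k`-hyponormal: the tuple `T(k)` of all monomials
`T₂^q T₁^p` with `1 ≤ p + q ≤ k` is jointly hyponormal. -/
def IsKHyponormal (k : ℕ) (T : (H →L[ℂ] H) × (H →L[ℂ] H)) : Prop :=
  Commute T.1 T.2 ∧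
    IsJointlyHyponormal fun m : ↥(pairExponents k) => T.2 ^ m.1.2 * T.1 ^ m.1.1

/-- The class `𝔥₀` of commuting pairs of subnormal operators. -/
def MemH0 (T : (H →L[ℂ] H) × (H →L[ℂ] H)) : Prop :=
  Commute T.1 T.2 ∧ IsSubnormal T.1 ∧ IsSubnormal T.2

/-- The class `𝔥ₖ` of `k`-hyponormal pairs in `𝔥₀`, for `k ≥ 1`. -/
def MemH (k : ℕ) (T : (H →L[ℂ] H) × (H →L[ℂ] H)) : Prop :=
  MemH0 T ∧ IsKHyponormal k T

/-- The power `T^{(h, l)} = (T₁^h, T₂^l)` of a pair. -/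
def pairPow (T : (H →L[ℂ] H) × (H →L[ℂ] H)) (h l : ℕ) : (H →L[ℂ] H) × (H →L[ℂ] H) :=
  (T.1 ^ h, T.2 ^ l)

end Operators

/-! ### 2-variable weighted shifts -/

/-- The Hilbert space `ℓ²(ℤ₊²)`. -/
abbrev EllTwo : Type := lp (fun _ : ℕ × ℕ => ℂ) 2

/-- The function `m ↦ w (m - ε) x (m - ε)`, extended by `0` to those `m` that are not `≥ ε`. -/
def shiftFun (w : ℕ × ℕ → ℝ) (ε : ℕ × ℕ) (x : ℕ × ℕ → ℂ) : ℕ × ℕ → ℂ :=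
  fun m => if ε ≤ m then (w (m - ε) : ℂ) * x (m - ε) else 0

theorem shiftFun_add (w : ℕ × ℕ → ℝ) (ε : ℕ × ℕ) (x : ℕ × ℕ → ℂ) (k : ℕ × ℕ) :
    shiftFun w ε x (k + ε) = (w k : ℂ) * x k := by
  simp [shiftFun]

theorem shiftFun_sum_le {w : ℕ × ℕ → ℝ} {C : ℝ} (hw : ∀ k, |w k| ≤ C) (ε : ℕ × ℕ)
    (x : EllTwo) (s : Finset (ℕ × ℕ)) :
    ∑ m ∈ s, ‖shiftFun w ε x m‖ ^ (2 : ENNReal).toReal ≤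
      (C * ‖x‖) ^ (2 : ENNReal).toReal := by
  have hp : 0 < (2 : ENNReal).toReal := by norm_num
  have hC : 0 ≤ C := (abs_nonneg _).trans (hw 0)
  have hinj : Set.InjOn (fun m : ℕ × ℕ => m - ε) (s.filter fun m => ε ≤ m) := by
    intro m hm m' hm' h
    simp only [Finset.coe_filter, Set.mem_ofPred_eq] at hm hm'
    have h' : m - ε = m' - ε := h
    rw [← tsub_add_cancel_of_le hm.2, ← tsub_add_cancel_of_le hm'.2, h']
  calc ∑ m ∈ s, ‖shiftFun w ε x m‖ ^ (2 : ENNReal).toReal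
      = ∑ m ∈ s.filter (fun m => ε ≤ m),
          ‖(w (m - ε) : ℂ) * x (m - ε)‖ ^ (2 : ENNReal).toReal := by
        rw [Finset.sum_filter]
        refine Finset.sum_congr rfl fun m _ => ?_
        by_cases h : ε ≤ m <;> simp [shiftFun, h]
    _ ≤ ∑ m ∈ s.filter (fun m => ε ≤ m),
          C ^ (2 : ENNReal).toReal * ‖x (m - ε)‖ ^ (2 : ENNReal).toReal := by
        refine Finset.sum_le_sum fun m _ => ?_
        rw [norm_mul, ← Real.mul_rpow hC (norm_nonneg _)]
        refine Real.rpow_le_rpow (by positivity) ?_ hp.le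
        refine mul_le_mul_of_nonneg_right ?_ (norm_nonneg _)
        simpa using hw (m - ε)
    _ = C ^ (2 : ENNReal).toReal *
          ∑ k ∈ (s.filter fun m => ε ≤ m).image (fun m => m - ε),
            ‖x k‖ ^ (2 : ENNReal).toReal := by
        rw [Finset.sum_image hinj, Finset.mul_sum]
    _ ≤ C ^ (2 : ENNReal).toReal * ‖x‖ ^ (2 : ENNReal).toReal :=
        mul_le_mul_of_nonneg_left (lp.sum_rpow_le_norm_rpow hp x _) (by positivity)
    _ = (C * ‖x‖) ^ (2 : ENNReal).toReal := (Real.mul_rpow hC (norm_nonneg _)).symm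

/-- The bounded operator on `ℓ²(ℤ₊²)` with `e_k ↦ w k • e_{k + ε}` for a bounded family `w`. -/
def shiftOp (w : ℕ × ℕ → ℝ) (hw : ∃ C, ∀ k, |w k| ≤ C) (ε : ℕ × ℕ) : EllTwo →L[ℂ] EllTwo :=
  LinearMap.mkContinuousOfExistsBound
    { toFun := fun x => ⟨shiftFun w ε x,
        hw.elim fun _ hC => memℓp_gen' (shiftFun_sum_le hC ε x)⟩
      map_add' := fun x y => by
        ext m
        change shiftFun w ε (x + y : EllTwo) m = shiftFun w ε x m + shiftFun w ε y m
        by_cases h : ε ≤ m <;> simp [shiftFun, h, mul_add]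
      map_smul' := fun c x => by
        ext m
        change shiftFun w ε (c • x : EllTwo) m = c * shiftFun w ε x m
        by_cases h : ε ≤ m <;> simp [shiftFun, h, mul_left_comm] }
    (hw.elim fun C hC => ⟨C, fun x => lp.norm_le_of_forall_sum_le (by norm_num)
      (mul_nonneg ((abs_nonneg _).trans (hC 0)) (norm_nonneg x)) (shiftFun_sum_le hC ε x)⟩)

theorem shiftOp_apply (w : ℕ × ℕ → ℝ) (hw : ∃ C, ∀ k, |w k| ≤ C) (ε : ℕ × ℕ) (x : EllTwo)
    (m : ℕ × ℕ) : shiftOp w hw ε x m = shiftFun w ε x m := rfl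

theorem shiftOp_single (w : ℕ × ℕ → ℝ) (hw : ∃ C, ∀ k, |w k| ≤ C) (ε k : ℕ × ℕ) :
    shiftOp w hw ε (lp.single 2 k (1 : ℂ)) = (w k : ℂ) • lp.single 2 (k + ε) (1 : ℂ) := by
  ext m
  rw [shiftOp_apply, lp.coeFn_smul, Pi.smul_apply, smul_eq_mul]
  by_cases h : ε ≤ m
  · obtain ⟨n, rfl⟩ := exists_add_of_le h
    rw [add_comm ε n, shiftFun_add]
    by_cases hn : n = k
    · subst hn; simp
    · simp [lp.single_apply, hn]
  · have hm : m ≠ k + ε := fun e => h (e ▸ le_add_self)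
    simp [shiftFun, h, lp.single_apply, hm]

/-- Two bounded families of positive weights indexed by `ℤ₊²`. -/
structure WeightPair where
  α : ℕ × ℕ → ℝ
  β : ℕ × ℕ → ℝ
  α_pos : ∀ k, 0 < α k
  β_pos : ∀ k, 0 < β k
  α_bdd : ∃ C, ∀ k, |α k| ≤ C
  β_bdd : ∃ C, ∀ k, |β k| ≤ C

/-- The 2-variable weighted shift `W_{(α, β)} = (T₁, T₂)` on `ℓ²(ℤ₊²)`, given by
`T₁ e_k = α_k e_{k + (1,0)}` and `T₂ e_k = β_k e_{k + (0,1)}`. -/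
def WeightPair.shift (W : WeightPair) : (EllTwo →L[ℂ] EllTwo) × (EllTwo →L[ℂ] EllTwo) :=
  (shiftOp W.α W.α_bdd (1, 0), shiftOp W.β W.β_bdd (0, 1))

/-! ### The family of shifts with parameters `a` and `κ` -/

/-- The weights `x₀ = κ √(3/4)` and `xₙ = √((n+1)(n+3)) / (n+2)` for `n ≥ 1`. -/
def xWeight (κ : ℝ) (n : ℕ) : ℝ :=
  if n = 0 then κ * √(3 / 4) else √(((n : ℝ) + 1) * ((n : ℝ) + 3)) / ((n : ℝ) + 2)

theorem xWeight_pos {κ : ℝ} (hκ : 0 < κ) (n : ℕ) : 0 < xWeight κ n := by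
  unfold xWeight
  split_ifs <;> positivity

theorem xWeight_prod_sq (κ : ℝ) (n : ℕ) :
    (∏ i ∈ Finset.range (n + 1), xWeight κ i) ^ 2 =
      κ ^ 2 * (((n : ℝ) + 3) / (2 * ((n : ℝ) + 2))) := by
  induction n with
  | zero =>
    simp only [zero_add, Finset.range_one, Finset.prod_singleton, xWeight, if_true, mul_pow]
    rw [Real.sq_sqrt (by norm_num)]
    norm_num
  | succ n ih =>
    rw [Finset.prod_range_succ, mul_pow, ih, xWeight, if_neg (Nat.succ_ne_zero n), div_pow,
      Real.sq_sqrt (by positivity)]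
    push_cast
    field_simp
    ring

theorem xWeight_prod_ge {κ : ℝ} (hκ : 0 < κ) (n : ℕ) :
    κ / 2 ≤ ∏ i ∈ Finset.range (n + 1), xWeight κ i := by
  refine le_of_sq_le_sq ?_ (Finset.prod_nonneg fun i _ => (xWeight_pos hκ i).le)
  rw [xWeight_prod_sq, div_pow, div_eq_mul_inv]
  refine mul_le_mul_of_nonneg_left ?_ (sq_nonneg κ)
  rw [le_div_iff₀ (by positivity)]
  have : (0 : ℝ) ≤ n := n.cast_nonneg
  linarith

/-- The weights `α_{(k₁,0)} = x_{k₁}`; on every higher row, `a, 1, 1, …`. -/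
def figAlpha (a κ : ℝ) (k : ℕ × ℕ) : ℝ :=
  if k.2 = 0 then xWeight κ k.1 else if k.1 = 0 then a else 1

/-- The weights `β_{(0,0)} = y := κ` and `β_{(k₁,0)} = a y / (x₀ ⋯ x_{k₁-1})` for `k₁ ≥ 1` on
the bottom row; `1` on every higher row. -/
def figBeta (a κ : ℝ) (k : ℕ × ℕ) : ℝ :=
  if k.2 = 0 then
    if k.1 = 0 then κ else a * κ / ∏ i ∈ Finset.range k.1, xWeight κ i
  else 1

theorem figAlpha_pos {a κ : ℝ} (ha : 0 < a) (hκ : 0 < κ) (k : ℕ × ℕ) : 0 < figAlpha a κ k := by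
  unfold figAlpha
  split_ifs
  exacts [xWeight_pos hκ _, ha, one_pos]

theorem figBeta_pos {a κ : ℝ} (ha : 0 < a) (hκ : 0 < κ) (k : ℕ × ℕ) : 0 < figBeta a κ k := by
  unfold figBeta
  split_ifs
  exacts [hκ, div_pos (mul_pos ha hκ) (Finset.prod_pos fun i _ => xWeight_pos hκ i), one_pos]

theorem figAlpha_bdd {a κ : ℝ} (ha : 0 < a) (hκ : 0 < κ) : ∃ C, ∀ k, |figAlpha a κ k| ≤ C := by
  refine ⟨κ + a + 1, fun k => ?_⟩
  rw [abs_of_pos (figAlpha_pos ha hκ k)]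
  unfold figAlpha xWeight
  split_ifs
  · have : √(3 / 4 : ℝ) ≤ 1 := Real.sqrt_le_one.mpr (by norm_num)
    nlinarith
  · have : √(((k.1 : ℝ) + 1) * ((k.1 : ℝ) + 3)) / ((k.1 : ℝ) + 2) ≤ 1 := by
      rw [div_le_one (by positivity)]
      exact Real.sqrt_le_iff.mpr ⟨by positivity, by nlinarith⟩
    linarith
  · linarith
  · linarith

theorem figBeta_bdd {a κ : ℝ} (ha : 0 < a) (hκ : 0 < κ) : ∃ C, ∀ k, |figBeta a κ k| ≤ C := by
  refine ⟨κ + 2 * a + 1, fun k => ?_⟩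
  rw [abs_of_pos (figBeta_pos ha hκ k)]
  unfold figBeta
  split_ifs with h2 h1
  · linarith
  · obtain ⟨n, hn⟩ := Nat.exists_eq_succ_of_ne_zero h1
    have hP := xWeight_prod_ge hκ n
    rw [hn, Nat.succ_eq_add_one, div_le_iff₀ (by linarith)]
    nlinarith
  · linarith

/-- The weights of the shift with parameters `a`, `κ`. -/
def figWeights (a κ : ℝ) (ha : 0 < a) (hκ : 0 < κ) : WeightPair where
  α := figAlpha a κ
  β := figBeta a κ
  α_pos := figAlpha_pos ha hκ
  β_pos := figBeta_pos ha hκ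
  α_bdd := figAlpha_bdd ha hκ
  β_bdd := figBeta_bdd ha hκ

/-- `h₂(a)`. -/
def hTwo (a : ℝ) : ℝ :=
  √(9 * (9 - 16 * a ^ 2) / (157 - 360 * a ^ 2 + 144 * a ^ 4))

/-- `h₂^{(2,1)}(a)`. -/
def hTwoPower (a : ℝ) : ℝ :=
  √(225 * (15 - 28 * a ^ 2) / (6238 - 15015 * a ^ 2 + 6300 * a ^ 4))

end

open ComplexConjugate MeasureTheory

/-! ### Joint hyponormality as positivity of a moment form -/

section JointHyponormality

variable {H : Type*} [NormedAddCommGroup H] [InnerProductSpace ℂ H] [CompleteSpace H]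

/-! Let `ρ k` be the product of the weights along a path from the origin to `k`. The squares `ρ k ^
2` are the moments of an explicit measure on the unit square, positive because `a² ≤ 1/2`, except at
the origin, where normalisation forces the value `1` instead of `κ² (2 - a²)`. The whole question is
how much of this single defect `2`-hyponormality tolerates.

Adjoining the identity to a tuple turns joint hyponormality into positivity of the form `∑ ⟨T_i x_j,
T_j x_i⟩` (`isJointlyHyponormal_iff_option`). For monomial shifts this form splits over `u ∈ ℤ²`
into real moment matrices with entries `Γ (u + m_i + m_j)`
(`isJointlyHyponormal_monomialShift_iff`). For `u ≠ 0` no relevant entry sees the origin, so each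
block is a sum of squares integrated against the measure (`figMoment_block_nonneg`). Only the `6 ×
6` block at `u = 0` remains. Minimising it over the five variables other than `y₀` leaves a multiple
of `y₀²`, affine in `κ²`, whose sign gives the threshold. Replacing `T₁` by `T₁²` merely doubles the
first exponents, so one family `originForm a κ d` serves both pairs.

Subnormality of each component comes from row and column measures of the form `c² δ₀ + d² ds + b²
δ₁`, realised by a multiplication operator tensored with a bilateral shift. -/

theorem inner_operatorMatrix {ι : Type*} [Fintype ι] (A : ι → ι → (H →L[ℂ] H))
    (x y : PiLp 2 (fun _ : ι => H)) :
    inner ℂ (operatorMatrix A x) y = ∑ i, ∑ j, inner ℂ (A i j (x j)) (y i) := by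
  rw [PiLp.inner_apply]
  refine Finset.sum_congr rfl fun i _ => ?_
  rw [operatorMatrix_apply, sum_inner]

theorem isJointlyHyponormal_iff_re_nonneg {ι : Type*} [Fintype ι] (T : ι → (H →L[ℂ] H)) :
    IsJointlyHyponormal T ↔ ∀ x : ι → H, 0 ≤ (∑ i, ∑ j, (inner ℂ (T i (x j)) (T j (x i)) -
      inner ℂ (ContinuousLinearMap.adjoint (T j) (x j))
        (ContinuousLinearMap.adjoint (T i) (x i)))).re := by
  have key : ∀ x y : ι → H, inner ℂ ((operatorMatrix fun i j =>
      ContinuousLinearMap.adjoint (T j) * T i - T i * ContinuousLinearMap.adjoint (T j))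
        (WithLp.toLp 2 x)) (WithLp.toLp 2 y) =
      ∑ i, ∑ j, (inner ℂ (T i (x j)) (T j (y i)) -
      inner ℂ (ContinuousLinearMap.adjoint (T j) (x j))
        (ContinuousLinearMap.adjoint (T i) (y i))) := by
    intro x y
    rw [inner_operatorMatrix]
    refine Finset.sum_congr rfl fun i _ => Finset.sum_congr rfl fun j _ => ?_
    have e1 : ∀ v w : H, inner ℂ ((ContinuousLinearMap.adjoint (T j) * T i -
        T i * ContinuousLinearMap.adjoint (T j)) v) w = inner ℂ (T i v) (T j w) -
        inner ℂ (ContinuousLinearMap.adjoint (T j) v) (ContinuousLinearMap.adjoint (T i) w) := by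
      intro v w
      rw [ContinuousLinearMap.adjoint_inner_right, ← ContinuousLinearMap.adjoint_inner_left,
        ← inner_sub_left]
      rfl
    exact e1 (x j) (y i)
  unfold IsJointlyHyponormal
  generalize (operatorMatrix fun i j => ContinuousLinearMap.adjoint (T j) * T i -
    T i * ContinuousLinearMap.adjoint (T j)) = A at key ⊢
  rw [ContinuousLinearMap.isPositive_def]
  constructor
  · intro h x
    rw [← key]
    have := h.2 (WithLp.toLp 2 x)
    rwa [ContinuousLinearMap.reApplyInnerSelf_apply] at this
  · intro h
    refine ⟨fun x y => ?_, fun x => ?_⟩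
    · have hs : ∀ x y : ι → H, inner ℂ (A (WithLp.toLp 2 x)) (WithLp.toLp 2 y) =
          inner ℂ (WithLp.toLp 2 x) (A (WithLp.toLp 2 y)) := by
        intro x y
        rw [← inner_conj_symm (WithLp.toLp 2 x), key, key, map_sum, Finset.sum_comm]
        refine Finset.sum_congr rfl fun i _ => ?_
        rw [map_sum]
        refine Finset.sum_congr rfl fun j _ => ?_
        rw [map_sub, inner_conj_symm, inner_conj_symm]
      exact hs x.ofLp y.ofLp
    · have := h x.ofLp
      rw [← key] at this
      rw [ContinuousLinearMap.reApplyInnerSelf_apply]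
      exact this

/-- Completing the square in the slot `none`, which carries the identity: the enlarged form is the
commutator form plus `‖x none + ∑ T_j^* x_j‖²`. This removes all adjoints from the condition. -/
theorem isJointlyHyponormal_iff_option {ι : Type*} [Fintype ι] (T : ι → (H →L[ℂ] H)) :
    IsJointlyHyponormal T ↔ ∀ x : Option ι → H,
      0 ≤ (∑ i : Option ι, ∑ j : Option ι, inner ℂ (i.elim 1 T (x j)) (j.elim 1 T (x i))).re := by
  rw [isJointlyHyponormal_iff_re_nonneg]
  have key : ∀ x : Option ι → H,
      ∑ i : Option ι, ∑ j : Option ι, inner ℂ (i.elim 1 T (x j)) (j.elim 1 T (x i)) =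
      (∑ i, ∑ j, (inner ℂ (T i (x (some j))) (T j (x (some i))) -
        inner ℂ (ContinuousLinearMap.adjoint (T j) (x (some j)))
          (ContinuousLinearMap.adjoint (T i) (x (some i))))) +
      inner ℂ (x none + ∑ j, ContinuousLinearMap.adjoint (T j) (x (some j)))
        (x none + ∑ j, ContinuousLinearMap.adjoint (T j) (x (some j))) := by
    intro x
    rw [inner_add_add_self, inner_sum, sum_inner, sum_inner]
    simp only [Fintype.sum_option, Option.elim, one_apply_eq_self,
      Finset.sum_sub_distrib, Finset.sum_add_distrib]
    have h1 : ∀ i, inner ℂ (x none) (ContinuousLinearMap.adjoint (T i) (x (some i))) =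
        inner ℂ (T i (x none)) (x (some i)) := fun i =>
      ContinuousLinearMap.adjoint_inner_right _ _ _
    have h2 : ∀ i, inner ℂ (ContinuousLinearMap.adjoint (T i) (x (some i))) (x none) =
        inner ℂ (x (some i)) (T i (x none)) := fun i =>
      ContinuousLinearMap.adjoint_inner_left _ _ _
    simp only [h1, h2, inner_sum]
    rw [Finset.sum_comm (f := fun i j => inner ℂ (ContinuousLinearMap.adjoint (T j) (x (some j)))
      (ContinuousLinearMap.adjoint (T i) (x (some i))))]
    ring

  constructor
  · intro h x
    rw [key, Complex.add_re]
    exact add_nonneg (h _) (inner_self_nonneg (𝕜 := ℂ))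
  · intro h x
    -- This value in the slot `none` makes the completed square vanish.
    have := h (fun o => o.elim (-∑ j, ContinuousLinearMap.adjoint (T j) (x j)) x)
    rw [key] at this
    simpa using this

end JointHyponormality

/-! ### Monomial shifts -/

/-- `S` is the shift by `m` on `ℓ²(ℤ₊²)` whose weight from `k` to `k + m` is `ρ (k + m) / ρ k`. -/
def IsMonomialShift (ρ : ℕ × ℕ → ℝ) (m : ℕ × ℕ) (S : EllTwo →L[ℂ] EllTwo) : Prop :=
  ∀ x p, S x p = if m ≤ p then ((ρ p / ρ (p - m) : ℝ) : ℂ) * x (p - m) else 0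

namespace IsMonomialShift

variable {ρ : ℕ × ℕ → ℝ} {m n : ℕ × ℕ} {S T : EllTwo →L[ℂ] EllTwo}

theorem one (hρ : ∀ k, 0 < ρ k) : IsMonomialShift ρ 0 1 := by
  intro x p
  simp [(hρ p).ne']

theorem mul (hρ : ∀ k, 0 < ρ k) (hS : IsMonomialShift ρ m S) (hT : IsMonomialShift ρ n T) :
    IsMonomialShift ρ (m + n) (S * T) := by
  intro x p
  rw [show (S * T) x = S (T x) from rfl, hS]
  by_cases hm : m ≤ p
  · rw [if_pos hm, hT]
    by_cases hn : n ≤ p - m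
    · rw [if_pos hn, if_pos ((le_tsub_iff_left hm).1 hn), tsub_tsub, ← mul_assoc,
        ← Complex.ofReal_mul, div_mul_div_cancel₀ (hρ _).ne']
    · rw [if_neg hn, if_neg fun h => hn ((le_tsub_iff_left hm).2 h), mul_zero]
  · rw [if_neg hm, if_neg fun h => hm (le_self_add.trans h)]

theorem pow (hρ : ∀ k, 0 < ρ k) (hS : IsMonomialShift ρ m S) (r : ℕ) :
    IsMonomialShift ρ (r • m) (S ^ r) := by
  induction r with
  | zero => simpa using one hρ
  | succ r ih => rw [pow_succ, succ_nsmul]; exact ih.mul hρ hS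

theorem unique (hS : IsMonomialShift ρ m S) (hT : IsMonomialShift ρ m T) : S = T := by
  ext x p
  rw [hS, hT]

theorem commute (hρ : ∀ k, 0 < ρ k) (hS : IsMonomialShift ρ m S) (hT : IsMonomialShift ρ n T) :
    Commute S T :=
  (hS.mul hρ hT).unique (by rw [add_comm]; exact hT.mul hρ hS)

theorem apply_single (hS : IsMonomialShift ρ m S) (k : ℕ × ℕ) (c : ℂ) :
    S (lp.single 2 k c) = lp.single 2 (k + m) (((ρ (k + m) / ρ k : ℝ) : ℂ) * c) := by
  ext p
  rw [hS]
  by_cases h : m ≤ p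
  · obtain ⟨q, rfl⟩ := exists_add_of_le h
    by_cases hq : q = k
    · subst hq; simp [add_comm m]
    · simp [lp.single_apply, add_comm m, hq]
  · have : p ≠ k + m := fun e => h (e ▸ le_add_self)
    simp [h, lp.single_apply, this]

end IsMonomialShift

theorem isMonomialShift_shiftOp {ρ w : ℕ × ℕ → ℝ} (hρ : ∀ k, 0 < ρ k)
    (hw : ∃ C, ∀ k, |w k| ≤ C) (ε : ℕ × ℕ) (h : ∀ k, ρ (k + ε) = w k * ρ k) :
    IsMonomialShift ρ ε (shiftOp w hw ε) := by
  intro x p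
  rw [shiftOp_apply]
  by_cases hp : ε ≤ p
  · obtain ⟨q, rfl⟩ := exists_add_of_le hp
    have := (hρ q).ne'
    rw [add_comm ε, shiftFun_add, if_pos le_add_self, h, add_tsub_cancel_right,
      mul_div_cancel_right₀ _ this]
  · simp [shiftFun, hp]

/-- The inclusion of `ℤ₊²` into `ℤ²`. -/
def toIntPair (k : ℕ × ℕ) : ℤ × ℤ := (k.1, k.2)

theorem toIntPair_add (k l : ℕ × ℕ) : toIntPair (k + l) = toIntPair k + toIntPair l := by
  simp [toIntPair]

theorem toIntPair_injective : Function.Injective toIntPair := by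
  rintro ⟨a, b⟩ ⟨c, d⟩ h
  simpa [toIntPair] using h

theorem toIntPair_nonneg (k : ℕ × ℕ) : 0 ≤ toIntPair k := by
  constructor <;> simp [toIntPair]

/-- The sequence `k ↦ x k / ρ k`, extended by `0` to `ℤ²`. -/
noncomputable def coeffExt (ρ : ℕ × ℕ → ℝ) (x : EllTwo) (q : ℤ × ℤ) : ℂ :=
  if 0 ≤ q then x (q.1.toNat, q.2.toNat) / ρ (q.1.toNat, q.2.toNat) else 0

theorem coeffExt_toIntPair (ρ : ℕ × ℕ → ℝ) (x : EllTwo) (k : ℕ × ℕ) :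
    coeffExt ρ x (toIntPair k) = x k / ρ k := by
  rw [coeffExt, if_pos (toIntPair_nonneg k)]
  simp [toIntPair]

theorem nonneg_of_coeffExt_ne_zero {ρ : ℕ × ℕ → ℝ} {x : EllTwo} {q : ℤ × ℤ}
    (h : coeffExt ρ x q ≠ 0) : 0 ≤ q := by
  by_contra hq
  exact h (if_neg hq)

theorem exists_toIntPair_eq {q : ℤ × ℤ} (h : 0 ≤ q) : ∃ k, toIntPair k = q :=
  ⟨(q.1.toNat, q.2.toNat), Prod.ext (Int.toNat_of_nonneg h.1) (Int.toNat_of_nonneg h.2)⟩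

theorem IsMonomialShift.apply_eq_coeffExt {ρ : ℕ × ℕ → ℝ} {m : ℕ × ℕ} {S : EllTwo →L[ℂ] EllTwo}
    (hS : IsMonomialShift ρ m S) (x : EllTwo) (p : ℕ × ℕ) :
    S x p = ρ p * coeffExt ρ x (toIntPair p - toIntPair m) := by
  rw [hS]
  by_cases h : m ≤ p
  · obtain ⟨q, rfl⟩ := exists_add_of_le h
    rw [if_pos h, toIntPair_add, add_sub_cancel_left, coeffExt_toIntPair, add_tsub_cancel_left]
    push_cast
    ring
  · rw [if_neg h, coeffExt, if_neg, mul_zero]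
    rintro ⟨h1, h2⟩
    simp only [toIntPair, Prod.fst_zero, Prod.snd_zero, Prod.fst_sub, Prod.snd_sub] at h1 h2
    exact h ⟨by omega, by omega⟩

/-- Reindexing the coordinate `p` by `u = p - m - n` makes the sum run over one index common to all
pairs of exponents. Since `u` can have negative entries, coefficients are extended by zero to `ℤ²`.
-/
theorem hasSum_inner_monomialShift {ρ : ℕ × ℕ → ℝ} {Γ : ℤ × ℤ → ℝ}
    (hΓ : ∀ k, Γ (toIntPair k) = ρ k ^ 2) {m n : ℕ × ℕ} {S T : EllTwo →L[ℂ] EllTwo}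
    (hS : IsMonomialShift ρ m S) (hT : IsMonomialShift ρ n T) (x y : EllTwo) :
    HasSum (fun u : ℤ × ℤ => (Γ (u + toIntPair m + toIntPair n) : ℂ) *
      (conj (coeffExt ρ x (u + toIntPair n)) * coeffExt ρ y (u + toIntPair m)))
      (inner ℂ (S x) (T y)) := by
  let g : ℕ × ℕ → ℤ × ℤ := fun p => toIntPair p - toIntPair m - toIntPair n
  have hg : Function.Injective g := fun p q h =>
    toIntPair_injective (sub_left_injective (sub_left_injective h))
  rw [← hg.hasSum_iff]
  · refine (lp.hasSum_inner (𝕜 := ℂ) (S x) (T y)).congr_fun fun p => ?_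
    have e1 : toIntPair p - toIntPair m - toIntPair n + toIntPair m = toIntPair p - toIntPair n := by
      abel
    rw [hS.apply_eq_coeffExt, hT.apply_eq_coeffExt]
    simp only [Function.comp_apply, g, RCLike.inner_apply, map_mul, Complex.conj_ofReal,
      e1, sub_add_cancel, hΓ]
    push_cast
    ring
  · intro u hu
    by_contra h
    have h1 := nonneg_of_coeffExt_ne_zero (right_ne_zero_of_mul (right_ne_zero_of_mul h))
    obtain ⟨k, hk⟩ := exists_toIntPair_eq h1
    exact hu ⟨k + n, by simp only [g]; rw [toIntPair_add, hk]; abel⟩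

/-- Joint hyponormality of a tuple of monomial shifts decouples into the positivity of finite
matrices of moments, one for each `u : ℤ²`. If all those with `u ≠ 0` are positive, only the one
with `u = 0` is left. -/
theorem isJointlyHyponormal_monomialShift_iff {ι : Type*} [Fintype ι] {ρ : ℕ × ℕ → ℝ}
    (hρ : ∀ k, 0 < ρ k) {Γ : ℤ × ℤ → ℝ} (hΓ : ∀ k, Γ (toIntPair k) = ρ k ^ 2)
    {m : ι → ℕ × ℕ} {T : ι → EllTwo →L[ℂ] EllTwo} (hT : ∀ i, IsMonomialShift ρ (m i) (T i))
    (hblock : ∀ u : ℤ × ℤ, u ≠ 0 → ∀ y : Option ι → ℝ,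
      (∀ i, y i ≠ 0 → 0 ≤ u + toIntPair (i.elim 0 m)) →
      0 ≤ ∑ i, ∑ j, Γ (u + toIntPair (i.elim 0 m) + toIntPair (j.elim 0 m)) * (y j * y i)) :
    IsJointlyHyponormal T ↔ ∀ y : Option ι → ℝ,
      0 ≤ ∑ i : Option ι, ∑ j : Option ι,
        Γ (toIntPair (i.elim 0 m) + toIntPair (j.elim 0 m)) * (y j * y i) := by
  rw [isJointlyHyponormal_iff_option]
  have hT' : ∀ i : Option ι, IsMonomialShift ρ (i.elim 0 m) (i.elim 1 T) := by
    rintro (_ | i)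
    exacts [IsMonomialShift.one hρ, hT i]
  constructor
  · intro h y
    -- With these vectors `T_i x_j` and `T_j x_i` are both multiples of the basis vector at `m_i +
    -- m_j`, so exactly the block `u = 0` is tested.
    have h1 := h fun i => lp.single 2 (i.elim 0 m) ((ρ (i.elim 0 m) * y i : ℝ) : ℂ)
    rw [Complex.re_sum] at h1
    convert h1 using 2 with i
    rw [Complex.re_sum]
    refine Finset.sum_congr rfl fun j _ => ?_
    have h2 := (hρ (i.elim 0 m)).ne'
    have h3 := (hρ (j.elim 0 m)).ne'
    rw [(hT' i).apply_single, (hT' j).apply_single, lp.inner_single_left,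
      add_comm (i.elim 0 m) (j.elim 0 m), lp.single_apply_self, ← Complex.ofReal_mul,
      ← Complex.ofReal_mul, RCLike.inner_apply, Complex.conj_ofReal, ← Complex.ofReal_mul,
      Complex.ofReal_re, add_comm (toIntPair _) (toIntPair _), ← toIntPair_add, hΓ]
    field_simp
  · intro h x
    have hs := Complex.hasSum_re (hasSum_sum (s := Finset.univ) fun i _ =>
      hasSum_sum (s := Finset.univ) fun j _ =>
        hasSum_inner_monomialShift hΓ (hT' i) (hT' j) (x j) (x i))
    refine hs.nonneg fun u => ?_
    have hall : ∀ y : Option ι → ℝ, (∀ i, y i ≠ 0 → 0 ≤ u + toIntPair (i.elim 0 m)) →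
        0 ≤ ∑ i, ∑ j, Γ (u + toIntPair (i.elim 0 m) + toIntPair (j.elim 0 m)) * (y j * y i) := by
      intro y hy
      by_cases hu : u = 0
      · simpa [hu] using h y
      · exact hblock u hu y hy
    -- The block is a real symmetric matrix, so the real part of its complex form is the sum of its
    -- values on the real and imaginary parts.
    have h1 := hall (fun i => (coeffExt ρ (x i) (u + toIntPair (i.elim 0 m))).re) fun i hi =>
      nonneg_of_coeffExt_ne_zero fun e => hi (by rw [e]; rfl)
    have h2 := hall (fun i => (coeffExt ρ (x i) (u + toIntPair (i.elim 0 m))).im) fun i hi =>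
      nonneg_of_coeffExt_ne_zero fun e => hi (by rw [e]; rfl)
    refine (add_nonneg h1 h2).trans_eq ?_
    simp only [Complex.re_sum, ← Finset.sum_add_distrib]
    refine Finset.sum_congr rfl fun i _ => Finset.sum_congr rfl fun j _ => ?_
    rw [Complex.re_ofReal_mul, Complex.mul_re, Complex.conj_re, Complex.conj_im]
    ring

/-! ### Subnormal shifts -/

section PermOp

variable {ι E : Type*} [NormedAddCommGroup E] [InnerProductSpace ℂ E]

theorem sum_rpow_norm_comp_perm_le (σ : Equiv.Perm ι) (M : E →L[ℂ] E)
    (f : lp (fun _ : ι => E) 2) (s : Finset ι) :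
    ∑ p ∈ s, ‖M (f (σ p))‖ ^ (2 : ENNReal).toReal ≤ (‖M‖ * ‖f‖) ^ (2 : ENNReal).toReal := by
  have hp : 0 < (2 : ENNReal).toReal := by norm_num
  calc ∑ p ∈ s, ‖M (f (σ p))‖ ^ (2 : ENNReal).toReal
      ≤ ∑ p ∈ s, ‖M‖ ^ (2 : ENNReal).toReal * ‖f (σ p)‖ ^ (2 : ENNReal).toReal := by
        refine Finset.sum_le_sum fun p _ => ?_
        rw [← Real.mul_rpow (norm_nonneg _) (norm_nonneg _)]
        exact Real.rpow_le_rpow (norm_nonneg _) (M.le_opNorm _) hp.le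
    _ = ‖M‖ ^ (2 : ENNReal).toReal *
          ∑ p ∈ s.map σ.toEmbedding, ‖f p‖ ^ (2 : ENNReal).toReal := by
        rw [Finset.sum_map, Finset.mul_sum]
        rfl
    _ ≤ ‖M‖ ^ (2 : ENNReal).toReal * ‖f‖ ^ (2 : ENNReal).toReal :=
        mul_le_mul_of_nonneg_left (lp.sum_rpow_le_norm_rpow hp f _) (by positivity)
    _ = (‖M‖ * ‖f‖) ^ (2 : ENNReal).toReal :=
        (Real.mul_rpow (norm_nonneg _) (norm_nonneg _)).symm

/-- The operator `f ↦ (p ↦ M (f (σ p)))` on the Hilbert sum of copies of `E`. -/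
noncomputable def permOp (σ : Equiv.Perm ι) (M : E →L[ℂ] E) :
    lp (fun _ : ι => E) 2 →L[ℂ] lp (fun _ : ι => E) 2 :=
  LinearMap.mkContinuous
    { toFun := fun f => ⟨fun p => M (f (σ p)), memℓp_gen' (sum_rpow_norm_comp_perm_le σ M f)⟩
      map_add' := fun f g => by
        ext p
        exact M.map_add (f (σ p)) (g (σ p))
      map_smul' := fun c f => by
        ext p
        exact M.map_smul c (f (σ p)) }
    ‖M‖ fun f => lp.norm_le_of_forall_sum_le (by norm_num) (by positivity)
      (sum_rpow_norm_comp_perm_le σ M f)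

theorem permOp_apply (σ : Equiv.Perm ι) (M : E →L[ℂ] E) (f : lp (fun _ : ι => E) 2) (p : ι) :
    permOp σ M f p = M (f (σ p)) := rfl

theorem permOp_single [DecidableEq ι] (σ : Equiv.Perm ι) (M : E →L[ℂ] E) (p : ι) (v : E) :
    permOp σ M (lp.single 2 (σ p) v) = lp.single 2 p (M v) := by
  ext q
  rw [permOp_apply]
  by_cases h : q = p
  · subst h; simp
  · rw [lp.single_apply_ne _ _ _ h, lp.single_apply_ne _ _ _ fun e => h (σ.injective e), map_zero]

variable [CompleteSpace E]

theorem adjoint_permOp (σ : Equiv.Perm ι) (M : E →L[ℂ] E) :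
    ContinuousLinearMap.adjoint (permOp σ M) =
      permOp σ.symm (ContinuousLinearMap.adjoint M) := by
  symm
  rw [ContinuousLinearMap.eq_adjoint_iff]
  intro f g
  rw [lp.inner_eq_tsum, lp.inner_eq_tsum, ← σ.tsum_eq]
  refine tsum_congr fun p => ?_
  rw [permOp_apply, permOp_apply, σ.symm_apply_apply, ContinuousLinearMap.adjoint_inner_left]

theorem isStarNormal_permOp (σ : Equiv.Perm ι) {M : E →L[ℂ] E} (hM : IsStarNormal M) :
    IsStarNormal (permOp σ M) := by
  constructor
  rw [ContinuousLinearMap.star_eq_adjoint, adjoint_permOp]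
  ext f p
  change ContinuousLinearMap.adjoint M (M (f (σ (σ.symm p)))) =
    M (ContinuousLinearMap.adjoint M (f (σ.symm (σ p))))
  rw [σ.symm_apply_apply, σ.apply_symm_apply]
  exact congrArg (fun A : E →L[ℂ] E => A (f p)) hM.star_comm_self

end PermOp

theorem IsSubnormal.pow {H : Type*} [NormedAddCommGroup H] [InnerProductSpace ℂ H]
    [CompleteSpace H] {T : H →L[ℂ] H} (hT : IsSubnormal T) (n : ℕ) : IsSubnormal (T ^ n) := by
  obtain ⟨K, i1, i2, i3, J, N, hN, h⟩ := hT
  refine ⟨K, i1, i2, i3, J, N ^ n, ⟨?_⟩, ?_⟩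
  · rw [star_pow]
    exact hN.star_comm_self.pow_pow n n
  · induction n with
    | zero => intro x; simp
    | succ n ih =>
      intro x
      rw [pow_succ, pow_succ]
      change (N ^ n) (N (J x)) = J ((T ^ n) (T x))
      rw [h, ih]

/-- A monomial shift is subnormal if its weights are realised by a normal operator `M` acting on
vectors `w k` of norm `ρ k` along which it is the translation `w k ↦ w (k + ε)`. -/
theorem IsMonomialShift.isSubnormal {ρ : ℕ × ℕ → ℝ} (hρ : ∀ k, 0 < ρ k) {ε : ℕ × ℕ}
    {S : EllTwo →L[ℂ] EllTwo} (hS : IsMonomialShift ρ ε S) {E : Type} [NormedAddCommGroup E]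
    [InnerProductSpace ℂ E] [CompleteSpace E] {M : E →L[ℂ] E} (hM : IsStarNormal M)
    (w : ℕ × ℕ → E) (hw : ∀ k, ‖w k‖ = ρ k) (hMw : ∀ k, M (w k) = w (k + ε)) :
    IsSubnormal S := by
  -- The vectors `w k` need not be orthogonal; tagging each by its position in `ℤ²` makes them so.
  -- The normal extension moves the tag by `ε` and applies `M`.
  let v : ℕ × ℕ → lp (fun _ : ℤ × ℤ => E) 2 := fun k =>
    lp.single 2 (toIntPair k) (((ρ k)⁻¹ : ℂ) • w k)
  have hv : Orthonormal ℂ v := by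
    constructor
    · intro k
      rw [lp.norm_single (by norm_num), norm_smul, hw, norm_inv, Complex.norm_real,
        Real.norm_of_nonneg (hρ k).le, inv_mul_cancel₀ (hρ k).ne']
    · intro k l hkl
      rw [lp.inner_single_left, lp.single_apply_ne _ _ _ fun e => hkl (toIntPair_injective e),
        inner_zero_right]
  let J := hv.orthogonalFamily.linearIsometry
  have hJ : ∀ k c, J (lp.single 2 k c) = c • v k := fun k c => by
    simp [J, OrthogonalFamily.linearIsometry_apply_single]
  let N := permOp (Equiv.subRight (toIntPair ε)) M
  refine ⟨_, _, _, inferInstance, J, N, isStarNormal_permOp _ hM, fun x => ?_⟩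
  have hext : N ∘L J.toContinuousLinearMap = J.toContinuousLinearMap ∘L S := by
    refine lp.ext_continuousLinearMap (by norm_num) fun k => ContinuousLinearMap.ext_ring ?_
    change N (J (lp.single 2 k 1)) = J (S (lp.single 2 k 1))
    rw [hS.apply_single, hJ, hJ, one_smul]
    have e : toIntPair k = Equiv.subRight (toIntPair ε) (toIntPair (k + ε)) := by
      simp [toIntPair_add]
    simp only [v]
    rw [e, permOp_single, map_smul, hMw, ← lp.single_smul, smul_smul]
    congr 2
    have h1 : (ρ k : ℂ) ≠ 0 := by exact_mod_cast (hρ k).ne'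
    have h2 : (ρ (k + ε) : ℂ) ≠ 0 := by exact_mod_cast (hρ (k + ε)).ne'
    push_cast
    field_simp
  exact congrArg (fun A : EllTwo →L[ℂ] lp (fun _ : ℤ × ℤ => E) 2 => A x) hext

/-! ### A multiplication operator realising the moments of `c² δ₀ + d² ds + b² δ₁` -/

/-- The function equal to `c` on `s ≤ 0`, to `d (√s)ⁿ` on `0 < s ≤ 1` and to `b` on `1 < s`. -/
noncomputable def pieceFun (c d b : ℝ) (n : ℕ) (s : ℝ) : ℝ :=
  if s ≤ 0 then c else if s ≤ 1 then d * √s ^ n else b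

theorem measurable_pieceFun (c d b : ℝ) (n : ℕ) : Measurable (pieceFun c d b n) :=
  Measurable.ite measurableSet_Iic measurable_const
    (Measurable.ite measurableSet_Iic (by fun_prop) measurable_const)

theorem abs_pieceFun_le (c d b : ℝ) (n : ℕ) (s : ℝ) :
    |pieceFun c d b n s| ≤ |c| + |d| + |b| := by
  have hc := abs_nonneg c
  have hd := abs_nonneg d
  have hb := abs_nonneg b
  unfold pieceFun
  split_ifs with h0 h1
  · linarith
  · rw [abs_mul, abs_of_nonneg (pow_nonneg (Real.sqrt_nonneg s) n)]
    have := pow_le_one₀ (n := n) (Real.sqrt_nonneg s) (Real.sqrt_le_one.mpr h1)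
    nlinarith
  · linarith

theorem pieceFun_mul (c d b : ℝ) (n : ℕ) (s : ℝ) :
    pieceFun 0 1 1 1 s * pieceFun c d b n s = pieceFun 0 d b (n + 1) s := by
  unfold pieceFun
  split_ifs <;> ring

theorem integral_pieceFun_sq (c d b : ℝ) (n : ℕ) :
    ∫ s in (-1 : ℝ)..2, pieceFun c d b n s ^ 2 = c ^ 2 + d ^ 2 / (n + 1) + b ^ 2 := by
  have hint : ∀ u v : ℝ, IntervalIntegrable (fun s => pieceFun c d b n s ^ 2) volume u v := by
    intro u v
    refine (intervalIntegrable_const (c := (|c| + |d| + |b|) ^ 2)).mono_fun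
      ((measurable_pieceFun c d b n).pow_const 2).aestronglyMeasurable (.of_forall fun s => ?_)
    simp only [norm_pow, Real.norm_eq_abs]
    rw [abs_of_nonneg (by positivity : 0 ≤ |c| + |d| + |b|)]
    exact pow_le_pow_left₀ (abs_nonneg _) (abs_pieceFun_le c d b n s) 2
  rw [← intervalIntegral.integral_add_adjacent_intervals (hint (-1) 0) (hint 0 2),
    ← intervalIntegral.integral_add_adjacent_intervals (hint 0 1) (hint 1 2)]
  have h1 : ∫ s in (-1 : ℝ)..0, pieceFun c d b n s ^ 2 = ∫ s in (-1 : ℝ)..0, c ^ 2 := by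
    refine intervalIntegral.integral_congr_Ioo_of_le (by norm_num) fun s hs => ?_
    simp [pieceFun, hs.2.le]
  have h2 : ∫ s in (0 : ℝ)..1, pieceFun c d b n s ^ 2 = ∫ s in (0 : ℝ)..1, d ^ 2 * s ^ n := by
    refine intervalIntegral.integral_congr_Ioo_of_le (by norm_num) fun s hs => ?_
    simp only [pieceFun, not_le.2 hs.1, hs.2.le, if_true, if_false]
    rw [mul_pow, ← pow_mul, mul_comm n, pow_mul, Real.sq_sqrt hs.1.le]
  have h3 : ∫ s in (1 : ℝ)..2, pieceFun c d b n s ^ 2 = ∫ s in (1 : ℝ)..2, b ^ 2 := by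
    refine intervalIntegral.integral_congr_Ioo_of_le (by norm_num) fun s hs => ?_
    simp [pieceFun, not_le.2 hs.1, not_le.2 (zero_lt_one.trans hs.1)]
  rw [h1, h2, h3, intervalIntegral.integral_const_mul, integral_pow]
  simp
  norm_num
  ring

/-- Multiplication on `L²((-1, 2])` by `0`, `√s`, `1` on the three unit intervals, which stand for
`δ₀`, `ds`, `δ₁`. The multiplier is real and bounded, hence self-adjoint as an operator. The square
root appears because squared norms must give `∫ sⁿ = 1 / (n + 1)`. -/
theorem exists_normal_realizing_moments :
    ∃ (E : Type) (_ : NormedAddCommGroup E) (_ : InnerProductSpace ℂ E) (_ : CompleteSpace E)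
      (M : E →L[ℂ] E) (w : ℝ → ℝ → ℝ → ℕ → E), IsStarNormal M ∧
      (∀ c d b n, M (w c d b n) = w 0 d b (n + 1)) ∧
      ∀ c d b n, ‖w c d b n‖ ^ 2 = c ^ 2 + d ^ 2 / (n + 1) + b ^ 2 := by
  let μ : Measure ℝ := volume.restrict (Set.Ioc (-1) 2)
  have hmem : ∀ (p : ENNReal) c d b n, MemLp (fun s => (pieceFun c d b n s : ℂ)) p μ := by
    intro p c d b n
    refine MemLp.of_bound (Complex.measurable_ofReal.comp
      (measurable_pieceFun c d b n)).aestronglyMeasurable (|c| + |d| + |b|) (.of_forall fun s => ?_)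
    rw [Complex.norm_real]
    exact abs_pieceFun_le c d b n s
  let Φ := (hmem ⊤ 0 1 1 1).toLp
  let M : Lp ℂ 2 μ →L[ℂ] Lp ℂ 2 μ := (ContinuousLinearMap.mul ℂ ℂ).holderL μ ⊤ 2 2 Φ
  have hM : ∀ f : Lp ℂ 2 μ, M f =ᵐ[μ] fun s => (pieceFun 0 1 1 1 s : ℂ) * f s := by
    intro f
    filter_upwards [(ContinuousLinearMap.mul ℂ ℂ).coeFn_holder (r := 2) Φ f,
      (hmem ⊤ 0 1 1 1).coeFn_toLp] with s h1 h2
    refine h1.trans ?_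
    rw [ContinuousLinearMap.mul_apply', h2]
  refine ⟨Lp ℂ 2 μ, inferInstance, inferInstance, inferInstance, M,
    fun c d b n => (hmem 2 c d b n).toLp, ?_, fun c d b n => ?_, fun c d b n => ?_⟩
  · refine IsSelfAdjoint.isStarNormal (x := M) ?_
    rw [ContinuousLinearMap.isSelfAdjoint_iff', eq_comm, ContinuousLinearMap.eq_adjoint_iff]
    intro f g
    rw [L2.inner_def, L2.inner_def]
    refine integral_congr_ae ?_
    filter_upwards [hM f, hM g] with s h1 h2
    rw [h1, h2, RCLike.inner_apply, RCLike.inner_apply, map_mul, Complex.conj_ofReal]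
    ring
  · refine Lp.ext ?_
    filter_upwards [hM (hmem 2 c d b n).toLp, (hmem 2 c d b n).coeFn_toLp,
      (hmem 2 0 d b (n + 1)).coeFn_toLp] with s h1 h2 h3
    rw [h1, h2, h3, ← pieceFun_mul c d b n s, Complex.ofReal_mul]
  · have h : (inner ℂ (hmem 2 c d b n).toLp (hmem 2 c d b n).toLp : ℂ) =
        ((c ^ 2 + d ^ 2 / (n + 1) + b ^ 2 : ℝ) : ℂ) := by
      rw [L2.inner_def, ← integral_pieceFun_sq, ← intervalIntegral.integral_ofReal,
        intervalIntegral.integral_of_le (by norm_num)]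
      refine integral_congr_ae ?_
      filter_upwards [(hmem 2 c d b n).coeFn_toLp] with s h1
      rw [h1, RCLike.inner_apply, Complex.conj_ofReal]
      push_cast
      ring
    rw [inner_self_eq_norm_sq_to_K] at h
    refine Complex.ofReal_injective ?_
    rw [← h, Complex.ofReal_pow]
    rfl

/-! ### The shift with parameters `a` and `κ` -/

/-- The unnormalised weights: `T₁`, `T₂` are the monomial shifts for `figRho a κ`. -/
noncomputable def figRho (a κ : ℝ) (k : ℕ × ℕ) : ℝ :=
  if k.2 = 0 then ∏ i ∈ Finset.range k.1, xWeight κ i else if k.1 = 0 then κ else a * κ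

/-- The moments of the measure
`κ² (a² δ₍₁,₁₎ + (1 - a²) δ₍₀,₁₎ + (1/2 - a²) δ₍₁,₀₎ + 1/2 ds ⊗ δ₀)`, corrected at the origin. -/
noncomputable def figMoment (a κ : ℝ) (p : ℤ × ℤ) : ℝ :=
  κ ^ 2 * (a ^ 2 + (if p.1 = 0 then 1 - a ^ 2 else 0) +
    (if p.2 = 0 then 1 / 2 - a ^ 2 + 1 / 2 * (1 / (p.1 + 1)) else 0)) +
    if p = 0 then 1 - κ ^ 2 * (2 - a ^ 2) else 0

section

variable {a κ : ℝ}

theorem figRho_pos (ha : 0 < a) (hκ : 0 < κ) (k : ℕ × ℕ) : 0 < figRho a κ k := by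
  unfold figRho
  split_ifs
  exacts [Finset.prod_pos fun i _ => xWeight_pos hκ i, hκ, mul_pos ha hκ]

theorem figMoment_toIntPair (a κ : ℝ) (k : ℕ × ℕ) :
    figMoment a κ (toIntPair k) = figRho a κ k ^ 2 := by
  obtain ⟨m, n⟩ := k
  rcases Nat.eq_zero_or_pos n with rfl | hn
  · cases m with
    | zero => simp [figMoment, figRho, toIntPair]; ring
    | succ m =>
      have h : (m : ℝ) + 1 + 1 ≠ 0 := by positivity
      have h' : (m : ℝ) + 2 ≠ 0 := by positivity
      have h0 : ((m : ℤ) + 1 = 0) = False := by simp; omega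
      simp only [figMoment, figRho, toIntPair, if_true, xWeight_prod_sq, Prod.ext_iff]
      simp [h0]
      field_simp
      exact .inl (by ring)
  · cases m with
    | zero => simp [figMoment, figRho, toIntPair, hn.ne', Prod.ext_iff]
    | succ m =>
      have h0 : ((m : ℤ) + 1 = 0) = False := by simp; omega
      simp [figMoment, figRho, toIntPair, hn.ne', Prod.ext_iff, h0]
      ring

theorem isMonomialShift_shift_fst (ha : 0 < a) (hκ : 0 < κ) :
    IsMonomialShift (figRho a κ) (1, 0) (figWeights a κ ha hκ).shift.1 := by
  refine isMonomialShift_shiftOp (figRho_pos ha hκ)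
    (figWeights a κ ha hκ).α_bdd _ fun k => ?_
  obtain ⟨m, n⟩ := k
  change figRho a κ (m + 1, n + 0) = figAlpha a κ (m, n) * figRho a κ (m, n)
  simp only [figRho, figAlpha, add_zero, Nat.succ_ne_zero, if_false]
  by_cases hn : n = 0
  · rw [if_pos hn, if_pos hn, if_pos hn, Finset.prod_range_succ, mul_comm]
  · by_cases hm : m = 0 <;> simp [hn, hm]

theorem isMonomialShift_shift_snd (ha : 0 < a) (hκ : 0 < κ) :
    IsMonomialShift (figRho a κ) (0, 1) (figWeights a κ ha hκ).shift.2 := by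
  refine isMonomialShift_shiftOp (figRho_pos ha hκ)
    (figWeights a κ ha hκ).β_bdd _ fun k => ?_
  obtain ⟨m, n⟩ := k
  change figRho a κ (m + 0, n + 1) = figBeta a κ (m, n) * figRho a κ (m, n)
  simp only [figRho, figBeta, add_zero, Nat.succ_ne_zero, if_false]
  by_cases hn : n = 0
  · by_cases hm : m = 0
    · simp [hn, hm]
    · have := (Finset.prod_pos fun i (_ : i ∈ Finset.range m) => xWeight_pos hκ i).ne'
      simp only [hn, hm, if_true, if_false]
      rw [div_mul_cancel₀ _ this]
  · simp [hn]

/-- The bottom row has moment measure `(1 - κ²) δ₀ + (κ²/2)(ds + δ₁)`, every higher row `κ² (1 - a²)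
δ₀ + a² κ² δ₁`. -/
theorem isSubnormal_shift_fst (ha : 0 < a) (ha1 : a ^ 2 ≤ 1 / 2) (hκ : 0 < κ) (hκ1 : κ < 1) :
    IsSubnormal (figWeights a κ ha hκ).shift.1 := by
  obtain ⟨E, _, _, _, M, w, hM, hMw, hw⟩ := exists_normal_realizing_moments
  have e1 : 0 ≤ 1 - κ ^ 2 := by nlinarith
  have e2 : 0 ≤ κ ^ 2 * (1 - a ^ 2) := mul_nonneg (sq_nonneg κ) (by linarith)
  obtain ⟨c, hc⟩ : ∃ c : ℝ, c ^ 2 = κ ^ 2 / 2 := ⟨_, Real.sq_sqrt (by positivity)⟩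
  refine (isMonomialShift_shift_fst ha hκ).isSubnormal (figRho_pos ha hκ) hM
    (fun k => if k.2 = 0 then
        w (if k.1 = 0 then √(1 - κ ^ 2) else 0) c c k.1
      else w (if k.1 = 0 then √(κ ^ 2 * (1 - a ^ 2)) else 0) 0 (a * κ) k.1)
    (fun k => ?_) (fun k => ?_)
  · rw [← sq_eq_sq₀ (norm_nonneg _) (figRho_pos ha hκ k).le, ← figMoment_toIntPair]
    obtain ⟨m, n⟩ := k
    by_cases hn : n = 0 <;> by_cases hm : m = 0 <;>
      simp [figMoment, toIntPair, hn, hm, hw, Real.sq_sqrt, e1, e2, hc, Prod.ext_iff] <;> ring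
  · obtain ⟨m, n⟩ := k
    by_cases hn : n = 0 <;> simp [hn, hMw]

/-- Every column measure lives on `{0, 1}`; the mass at `0` in column `m ≥ 1` is nonnegative because
`a² ≤ 1/2`. -/
theorem isSubnormal_shift_snd (ha : 0 < a) (ha1 : a ^ 2 ≤ 1 / 2) (hκ : 0 < κ) (hκ1 : κ < 1) :
    IsSubnormal (figWeights a κ ha hκ).shift.2 := by
  obtain ⟨E, _, _, _, M, w, hM, hMw, hw⟩ := exists_normal_realizing_moments
  have e1 : 0 ≤ 1 - κ ^ 2 := by nlinarith
  have e2 : ∀ m : ℕ, 0 ≤ κ ^ 2 * (1 / 2 - a ^ 2 + 1 / 2 * (1 / (m + 1))) := fun m =>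
    mul_nonneg (sq_nonneg κ) (add_nonneg (by linarith) (by positivity))
  refine (isMonomialShift_shift_snd ha hκ).isSubnormal (figRho_pos ha hκ) hM
    (fun k => w (if k.2 = 0 then if k.1 = 0 then √(1 - κ ^ 2) else
        √(κ ^ 2 * (1 / 2 - a ^ 2 + 1 / 2 * (1 / (k.1 + 1)))) else 0) 0
      (if k.1 = 0 then κ else a * κ) k.2)
    (fun k => ?_) (fun k => ?_)
  · rw [← sq_eq_sq₀ (norm_nonneg _) (figRho_pos ha hκ k).le, ← figMoment_toIntPair, hw]
    obtain ⟨m, n⟩ := k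
    have e3 := Real.sq_sqrt (e2 m)
    by_cases hn : n = 0 <;> by_cases hm : m = 0 <;>
      simp only [figMoment, toIntPair, hn, hm, Prod.ext_iff, if_true, if_false, e3,
        Real.sq_sqrt e1] <;> simp [hn, hm] <;> ring
  · obtain ⟨m, n⟩ := k
    simp [hMw]

theorem memH0_shift (ha : 0 < a) (ha1 : a ^ 2 ≤ 1 / 2) (hκ : 0 < κ) (hκ1 : κ < 1) :
    MemH0 (figWeights a κ ha hκ).shift :=
  ⟨(isMonomialShift_shift_fst ha hκ).commute (figRho_pos ha hκ) (isMonomialShift_shift_snd ha hκ),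
    isSubnormal_shift_fst ha ha1 hκ hκ1, isSubnormal_shift_snd ha ha1 hκ hκ1⟩

end

theorem MemH0.pairPow {H : Type*} [NormedAddCommGroup H] [InnerProductSpace ℂ H]
    [CompleteSpace H] {T : (H →L[ℂ] H) × (H →L[ℂ] H)} (hT : MemH0 T) (h l : ℕ) :
    MemH0 (pairPow T h l) :=
  ⟨hT.1.pow_pow h l, hT.2.1.pow h, hT.2.2.pow l⟩

/-! ### Positivity of the blocks away from the origin -/

/-- Cauchy matrices with positive parameters are positive semidefinite. -/
theorem sum_sum_mul_one_div_add_nonneg {I : Type*} [Fintype I] (z t : I → ℝ) (ht : ∀ i, 0 < t i) :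
    0 ≤ ∑ i, ∑ j, z j * z i * (1 / (t i + t j)) := by
  have hr : ∀ i j, -1 < t i + t j - 1 := fun i j => by linarith [ht i, ht j]
  have key : ∑ i, ∑ j, z j * z i * (1 / (t i + t j)) =
      ∫ s in (0 : ℝ)..1, ∑ i, ∑ j, z j * z i * s ^ (t i + t j - 1) := by
    rw [intervalIntegral.integral_finsetSum fun i _ => ?_]
    · refine Finset.sum_congr rfl fun i _ => ?_
      rw [intervalIntegral.integral_finsetSum fun j _ => ?_]
      · refine Finset.sum_congr rfl fun j _ => ?_
        rw [intervalIntegral.integral_const_mul, integral_rpow (.inl (hr i j)), sub_add_cancel,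
          Real.one_rpow, Real.zero_rpow (add_pos (ht i) (ht j)).ne', sub_zero]
      · exact (intervalIntegral.intervalIntegrable_rpow' (hr i j)).const_mul _
    · have h := IntervalIntegrable.sum Finset.univ fun j _ =>
        (intervalIntegral.intervalIntegrable_rpow' (a := 0) (b := 1) (hr i j)).const_mul (z j * z i)
      rwa [Finset.sum_fn] at h
  rw [key, intervalIntegral.integral_of_le zero_le_one]
  refine setIntegral_nonneg measurableSet_Ioc fun s hs => ?_
  -- The exponent `-1` is split evenly between the two factors, so the integrand is a square.
  have : ∑ i, ∑ j, z j * z i * s ^ (t i + t j - 1) = (∑ i, z i * s ^ (t i - 1 / 2)) ^ 2 := by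
    rw [sq, Finset.sum_mul_sum]
    refine Finset.sum_congr rfl fun i _ => Finset.sum_congr rfl fun j _ => ?_
    rw [show t i + t j - 1 = (t i - 1 / 2) + (t j - 1 / 2) by ring, Real.rpow_add hs.1]
    ring
  rw [this]
  exact sq_nonneg _

/-- Each of the three atoms contributes a square and the segment a Cauchy form, all with nonnegative
coefficients. -/
theorem figMoment_block_nonneg {a : ℝ} (ha1 : a ^ 2 ≤ 1 / 2) (κ : ℝ) {I : Type*} [Fintype I]
    (n : I → ℕ × ℕ) (u : ℤ × ℤ) (hu : u ≠ 0) (y : I → ℝ)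
    (hy : ∀ i, y i ≠ 0 → 0 ≤ u + toIntPair (n i)) :
    0 ≤ ∑ i, ∑ j, figMoment a κ (u + toIntPair (n i) + toIntPair (n j)) * (y j * y i) := by
  let z₁ : I → ℝ := fun i => if u.1 = 0 ∧ (n i).1 = 0 then y i else 0
  let z₂ : I → ℝ := fun i => if u.2 = 0 ∧ (n i).2 = 0 then y i else 0
  -- Half of `u.1 + 1` goes to each index, so that `t i + t j` is the denominator of the moment; the
  -- value `1` off the support of `y` only keeps `t` positive.
  let t : I → ℝ := fun i => if y i = 0 then 1 else (n i).1 + ((u.1 : ℝ) + 1) / 2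
  have ht : ∀ i, 0 < t i := by
    intro i
    simp only [t]
    split_ifs with h
    · exact one_pos
    · have h1 : 0 ≤ u.1 + ((n i).1 : ℤ) := (hy i h).1
      have h2 : (0 : ℝ) ≤ u.1 + (n i).1 := by exact_mod_cast h1
      have h3 : (0 : ℝ) ≤ (n i).1 := Nat.cast_nonneg _
      linarith
  have hterm : ∀ i j, figMoment a κ (u + toIntPair (n i) + toIntPair (n j)) * (y j * y i) =
      κ ^ 2 * a ^ 2 * (y j * y i) + κ ^ 2 * (1 - a ^ 2) * (z₁ j * z₁ i) +
      κ ^ 2 * (1 / 2 - a ^ 2) * (z₂ j * z₂ i) +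
      κ ^ 2 / 2 * (z₂ j * z₂ i * (1 / (t i + t j))) := by
    intro i j
    by_cases hi : y i = 0
    · simp [z₁, z₂, hi]
    by_cases hj : y j = 0
    · simp [z₁, z₂, hj]
    obtain ⟨hi1, hi2⟩ := hy i hi
    obtain ⟨hj1, hj2⟩ := hy j hj
    simp only [toIntPair, Prod.fst_add, Prod.snd_add, Prod.fst_zero, Prod.snd_zero] at hi1 hi2 hj1 hj2
    -- Both `u + n i` and `n j` are nonnegative, so a zero sum forces `n j = 0`, by symmetry `n i =
    -- 0`, and then `u = 0`. Hence the correction at the origin never enters.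
    have h0 : u + toIntPair (n i) + toIntPair (n j) ≠ 0 := by
      intro h
      rw [Prod.ext_iff] at h
      simp only [toIntPair, Prod.fst_add, Prod.snd_add, Prod.fst_zero, Prod.snd_zero] at h
      exact hu (Prod.ext (by simp; omega) (by simp; omega))
    have h1 : (u + toIntPair (n i) + toIntPair (n j)).1 = 0 ↔
        (u.1 = 0 ∧ (n j).1 = 0) ∧ (u.1 = 0 ∧ (n i).1 = 0) := by
      simp only [toIntPair, Prod.fst_add]
      omega
    have h2 : (u + toIntPair (n i) + toIntPair (n j)).2 = 0 ↔
        (u.2 = 0 ∧ (n j).2 = 0) ∧ (u.2 = 0 ∧ (n i).2 = 0) := by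
      simp only [toIntPair, Prod.snd_add]
      omega
    have h3 : (((u + toIntPair (n i) + toIntPair (n j)).1 : ℤ) : ℝ) + 1 = t i + t j := by
      simp only [toIntPair, Prod.fst_add, t, hi, hj, if_false]
      push_cast
      ring
    have hz₁ : z₁ j * z₁ i = if (u + toIntPair (n i) + toIntPair (n j)).1 = 0 then y j * y i
        else 0 := by
      simp only [z₁, h1, ite_zero_mul_ite_zero]
    have hz₂ : z₂ j * z₂ i = if (u + toIntPair (n i) + toIntPair (n j)).2 = 0 then y j * y i
        else 0 := by
      simp only [z₂, h2, ite_zero_mul_ite_zero]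
    rw [hz₁, hz₂, figMoment, if_neg h0, h3]
    split_ifs <;> ring
  have hsq : ∀ z : I → ℝ, 0 ≤ ∑ i, ∑ j, z j * z i := by
    intro z
    have : ∑ i, ∑ j, z j * z i = (∑ i, z i) ^ 2 := by
      rw [sq, Finset.sum_mul_sum]
      exact Finset.sum_congr rfl fun i _ => Finset.sum_congr rfl fun j _ => mul_comm _ _
    rw [this]
    exact sq_nonneg _
  simp only [hterm, Finset.sum_add_distrib, ← Finset.mul_sum]
  have c1 : 0 ≤ 1 - a ^ 2 := by linarith
  have c2 : 0 ≤ 1 / 2 - a ^ 2 := by linarith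
  have p1 := hsq y
  have p2 := hsq z₁
  have p3 := hsq z₂
  have p4 := sum_sum_mul_one_div_add_nonneg z₂ t ht
  positivity

/-! ### The block at the origin -/

theorem sum_pairExponents_two {M : Type*} [AddCommMonoid M] (f : ↥(pairExponents 2) → M) :
    ∑ i, f i = f ⟨(1, 0), by decide⟩ + (f ⟨(0, 1), by decide⟩ + (f ⟨(2, 0), by decide⟩ +
      (f ⟨(1, 1), by decide⟩ + f ⟨(0, 2), by decide⟩))) := by
  have : (Finset.univ : Finset ↥(pairExponents 2)) = {⟨(1, 0), by decide⟩, ⟨(0, 1), by decide⟩,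
      ⟨(2, 0), by decide⟩, ⟨(1, 1), by decide⟩, ⟨(0, 2), by decide⟩} := by decide
  rw [this]
  simp [Finset.sum_insert]

theorem forall_option_pairExponents_two {P : ℝ → ℝ → ℝ → ℝ → ℝ → ℝ → Prop} :
    (∀ y : Option ↥(pairExponents 2) → ℝ, P (y none) (y (some ⟨(1, 0), by decide⟩))
      (y (some ⟨(0, 1), by decide⟩)) (y (some ⟨(2, 0), by decide⟩))
      (y (some ⟨(1, 1), by decide⟩)) (y (some ⟨(0, 2), by decide⟩))) ↔
      ∀ y₀ y₁ y₂ y₃ y₄ y₅, P y₀ y₁ y₂ y₃ y₄ y₅ := by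
  refine ⟨fun h y₀ y₁ y₂ y₃ y₄ y₅ => ?_, fun h y => h _ _ _ _ _ _⟩
  exact h fun o => o.elim y₀ fun i => if i.1 = (1, 0) then y₁ else if i.1 = (0, 1) then y₂ else
    if i.1 = (2, 0) then y₃ else if i.1 = (1, 1) then y₄ else y₅

/-- The form of the block at the origin, for the exponents `(d p, q)` with `p + q ≤ 2`. -/
noncomputable def originForm (a κ : ℝ) (d : ℕ) (y₀ y₁ y₂ y₃ y₄ y₅ : ℝ) : ℝ :=
  κ ^ 2 * (a ^ 2 * (y₀ + y₁ + y₂ + y₃ + y₄ + y₅) ^ 2 + (1 - a ^ 2) * (y₀ + y₂ + y₅) ^ 2 +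
    (1 / 2 - a ^ 2) * (y₀ + y₁ + y₃) ^ 2 + 1 / 2 * (y₀ ^ 2 + y₁ ^ 2 / (2 * d + 1) +
      y₃ ^ 2 / (4 * d + 1) + 2 * y₀ * y₁ / (d + 1) + 2 * y₀ * y₃ / (2 * d + 1) +
      2 * y₁ * y₃ / (3 * d + 1))) + (1 - κ ^ 2 * (2 - a ^ 2)) * y₀ ^ 2

theorem sum_figMoment_eq_originForm (a κ : ℝ) {d : ℕ} (hd : d ≠ 0)
    (y : Option ↥(pairExponents 2) → ℝ) :
    ∑ i : Option ↥(pairExponents 2), ∑ j : Option ↥(pairExponents 2),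
      figMoment a κ (toIntPair (i.elim 0 fun m => (d * m.1.1, m.1.2)) +
        toIntPair (j.elim 0 fun m => (d * m.1.1, m.1.2))) * (y j * y i) =
    originForm a κ d (y none) (y (some ⟨(1, 0), by decide⟩))
      (y (some ⟨(0, 1), by decide⟩)) (y (some ⟨(2, 0), by decide⟩))
      (y (some ⟨(1, 1), by decide⟩)) (y (some ⟨(0, 2), by decide⟩)) := by
  have h1 : ((d : ℤ) + d = 0) = False := by simp; omega
  have h2 : ((d : ℤ) + d * 2 = 0) = False := by simp; omega
  have h3 : ((d : ℤ) * 2 + d = 0) = False := by simp; omega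
  have h4 : ((d : ℤ) * 2 + d * 2 = 0) = False := by simp; omega
  have h5 : ((d : ℤ) * 2 = 0) = False := by simp; omega
  have h6 : (d * 2 = 0) = False := by simp; omega
  simp only [Fintype.sum_option, sum_pairExponents_two, Option.elim, toIntPair, figMoment,
    Prod.fst_add, Prod.snd_add, Prod.ext_iff, Prod.fst_zero, Prod.snd_zero, mul_zero, mul_one,
    Nat.cast_zero, Nat.cast_one, add_zero, zero_add, Nat.cast_mul, Nat.cast_ofNat, h1, h2, h3, h4,
    h5, h6, Nat.cast_eq_zero, hd, if_false, if_true, and_false, and_true, and_self,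
    Int.reduceAdd, one_ne_zero, OfNat.ofNat_ne_zero, originForm]
  push_cast
  ring

section

variable {a κ : ℝ}

/-- The variables `y₂` and `y₄` can annihilate the squares from `δ₍₀,₁₎` and `δ₍₁,₁₎`. What is left
is a form in `y₀, y₁, y₃`, and its Schur complement at `y₀` decides the sign. -/
theorem originForm_one_nonneg_iff (ha1 : a ^ 2 ≤ 1 / 2) :
    (∀ y₀ y₁ y₂ y₃ y₄ y₅, 0 ≤ originForm a κ 1 y₀ y₁ y₂ y₃ y₄ y₅) ↔
      κ ^ 2 * (157 - 360 * a ^ 2 + 144 * a ^ 4) ≤ 9 * (9 - 16 * a ^ 2) := by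
  obtain ⟨p, hp⟩ : ∃ p, a ^ 2 = (1 - p) / 2 := ⟨1 - 2 * a ^ 2, by ring⟩
  have hp0 : 0 ≤ p := by linarith
  have hq : 0 < 8 * p + 1 := by linarith
  -- The shifts of `y₁` and `y₃` solve the normal equations; `1/3, 3/4, 1/80` diagonalise the Gram
  -- matrix of `s, s²` on `[0, 1]`. After adding `p` times the all-ones matrix its determinant is
  -- `(8 p + 1) / 240`, and `8 p + 1 = 9 - 16 a²`.
  have key : ∀ y₀ y₁ y₂ y₃ y₄ y₅, originForm a κ 1 y₀ y₁ y₂ y₃ y₄ y₅ =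
      κ ^ 2 * (a ^ 2 * (y₀ + y₁ + y₂ + y₃ + y₄ + y₅) ^ 2 + (1 - a ^ 2) * (y₀ + y₂ + y₅) ^ 2 +
        1 / 2 * (p * ((y₁ + (28 * p + 4) / (8 * p + 1) * y₀) +
          (y₃ - (60 * p + 10) / (3 * (8 * p + 1)) * y₀)) ^ 2 +
          1 / 3 * ((y₁ + (28 * p + 4) / (8 * p + 1) * y₀) +
          3 / 4 * (y₃ - (60 * p + 10) / (3 * (8 * p + 1)) * y₀)) ^ 2 +
          1 / 80 * (y₃ - (60 * p + 10) / (3 * (8 * p + 1)) * y₀) ^ 2)) +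
      (9 * (9 - 16 * a ^ 2) - κ ^ 2 * (157 - 360 * a ^ 2 + 144 * a ^ 4)) /
        (9 * (8 * p + 1)) * y₀ ^ 2 := by
    intro y₀ y₁ y₂ y₃ y₄ y₅
    rw [originForm, show a ^ 4 = (a ^ 2) ^ 2 by ring, hp]
    push_cast
    field_simp
    ring
  constructor
  · intro h
    -- The minimiser for `y₀ = 1`: every square in `key` vanishes.
    have h1 := h 1 (-((28 * p + 4) / (8 * p + 1))) (-1) ((60 * p + 10) / (3 * (8 * p + 1)))
      ((28 * p + 4) / (8 * p + 1) - (60 * p + 10) / (3 * (8 * p + 1))) 0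
    rw [key] at h1
    ring_nf at h1
    have h2 : 0 ≤ (9 * (9 - 16 * a ^ 2) - κ ^ 2 * (157 - 360 * a ^ 2 + 144 * a ^ 4)) /
        (9 * (8 * p + 1)) := by
      refine h1.trans_eq ?_
      ring
    have h3 := mul_nonneg h2 (by positivity : 0 ≤ 9 * (8 * p + 1))
    rw [div_mul_cancel₀ _ (by positivity)] at h3
    linarith
  · intro h y₀ y₁ y₂ y₃ y₄ y₅
    rw [key]
    have h1 : 0 ≤ 1 - a ^ 2 := by linarith
    have h2 := sub_nonneg.2 h
    positivity

theorem originForm_two_nonneg_iff (ha1 : a ^ 2 ≤ 1 / 2) :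
    (∀ y₀ y₁ y₂ y₃ y₄ y₅, 0 ≤ originForm a κ 2 y₀ y₁ y₂ y₃ y₄ y₅) ↔
      κ ^ 2 * (6238 - 15015 * a ^ 2 + 6300 * a ^ 4) ≤ 225 * (15 - 28 * a ^ 2) := by
  obtain ⟨p, hp⟩ : ∃ p, a ^ 2 = (1 - p) / 2 := ⟨1 - 2 * a ^ 2, by ring⟩
  have hp0 : 0 ≤ p := by linarith
  have hq : 0 < 14 * p + 1 := by linarith
  -- The same reduction with the Gram matrix of `s², s⁴`, diagonalised by `1/5, 5/7, 4/441`; here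
  -- `14 p + 1 = 15 - 28 a²`.
  have key : ∀ y₀ y₁ y₂ y₃ y₄ y₅, originForm a κ 2 y₀ y₁ y₂ y₃ y₄ y₅ =
      κ ^ 2 * (a ^ 2 * (y₀ + y₁ + y₂ + y₃ + y₄ + y₅) ^ 2 + (1 - a ^ 2) * (y₀ + y₂ + y₅) ^ 2 +
        1 / 2 * (p * ((y₁ + (168 * p + 14) / (3 * (14 * p + 1)) * y₀) +
          (y₃ - (210 * p + 21) / (5 * (14 * p + 1)) * y₀)) ^ 2 +
          1 / 5 * ((y₁ + (168 * p + 14) / (3 * (14 * p + 1)) * y₀) +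
          5 / 7 * (y₃ - (210 * p + 21) / (5 * (14 * p + 1)) * y₀)) ^ 2 +
          4 / 441 * (y₃ - (210 * p + 21) / (5 * (14 * p + 1)) * y₀) ^ 2)) +
      (225 * (15 - 28 * a ^ 2) - κ ^ 2 * (6238 - 15015 * a ^ 2 + 6300 * a ^ 4)) /
        (225 * (14 * p + 1)) * y₀ ^ 2 := by
    intro y₀ y₁ y₂ y₃ y₄ y₅
    rw [originForm, show a ^ 4 = (a ^ 2) ^ 2 by ring, hp]
    push_cast
    field_simp
    ring
  constructor
  · intro h
    have h1 := h 1 (-((168 * p + 14) / (3 * (14 * p + 1)))) (-1)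
      ((210 * p + 21) / (5 * (14 * p + 1)))
      ((168 * p + 14) / (3 * (14 * p + 1)) - (210 * p + 21) / (5 * (14 * p + 1))) 0
    rw [key] at h1
    ring_nf at h1
    have h2 : 0 ≤ (225 * (15 - 28 * a ^ 2) - κ ^ 2 * (6238 - 15015 * a ^ 2 + 6300 * a ^ 4)) /
        (225 * (14 * p + 1)) := by
      refine h1.trans_eq ?_
      ring
    have h3 := mul_nonneg h2 (by positivity : 0 ≤ 225 * (14 * p + 1))
    rw [div_mul_cancel₀ _ (by positivity)] at h3
    linarith
  · intro h y₀ y₁ y₂ y₃ y₄ y₅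
    rw [key]
    have h1 : 0 ≤ 1 - a ^ 2 := by linarith
    have h2 := sub_nonneg.2 h
    positivity

theorem isKHyponormal_two_pairPow_iff (ha : 0 < a) (ha1 : a ^ 2 ≤ 1 / 2) (hκ : 0 < κ) {d : ℕ}
    (hd : d ≠ 0) :
    IsKHyponormal 2 (pairPow (figWeights a κ ha hκ).shift d 1) ↔
      ∀ y₀ y₁ y₂ y₃ y₄ y₅, 0 ≤ originForm a κ d y₀ y₁ y₂ y₃ y₄ y₅ := by
  have hρ := figRho_pos ha hκ
  have h1 : IsMonomialShift (figRho a κ) (d, 0) (pairPow (figWeights a κ ha hκ).shift d 1).1 := by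
    have := (isMonomialShift_shift_fst ha hκ).pow hρ d
    rwa [show d • ((1, 0) : ℕ × ℕ) = (d, 0) by simp] at this
  have h2 : IsMonomialShift (figRho a κ) (0, 1) (pairPow (figWeights a κ ha hκ).shift d 1).2 := by
    have := (isMonomialShift_shift_snd ha hκ).pow hρ 1
    rwa [one_smul] at this
  have h3 : ∀ m : ↥(pairExponents 2), IsMonomialShift (figRho a κ) (d * m.1.1, m.1.2)
      ((pairPow (figWeights a κ ha hκ).shift d 1).2 ^ m.1.2 *
        (pairPow (figWeights a κ ha hκ).shift d 1).1 ^ m.1.1) := by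
    intro m
    have := (h2.pow hρ m.1.2).mul hρ (h1.pow hρ m.1.1)
    rwa [show m.1.2 • ((0, 1) : ℕ × ℕ) + m.1.1 • ((d, 0) : ℕ × ℕ) = (d * m.1.1, m.1.2) by
      simp [mul_comm]] at this
  rw [IsKHyponormal, and_iff_right (h1.commute hρ h2),
    isJointlyHyponormal_monomialShift_iff hρ (figMoment_toIntPair a κ) h3
      fun u hu y hy => figMoment_block_nonneg ha1 κ _ u hu y hy,
    ← forall_option_pairExponents_two]
  exact forall_congr' fun y => by rw [sum_figMoment_eq_originForm a κ hd]

end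

/-! ### The thresholds and their comparison -/

theorem theorem6p3 (a : ℝ) (ha₀ : 0 < a) (ha₁ : a ≤ √(1 / 2)) :
    (∀ (κ : ℝ) (hκ₀ : 0 < κ), κ < 1 →
      MemH0 (figWeights a κ ha₀ hκ₀).shift ∧
      (MemH 2 (figWeights a κ ha₀ hκ₀).shift ↔ κ ≤ hTwo a) ∧
      (MemH 2 (pairPow (figWeights a κ ha₀ hκ₀).shift 2 1) ↔ κ ≤ hTwoPower a)) ∧
    hTwo a < hTwoPower a := by
  have ha1 : a ^ 2 ≤ 1 / 2 := (Real.le_sqrt' ha₀).1 ha₁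
  have ha4 : a ^ 4 = (a ^ 2) ^ 2 := by ring
  have hD1 : 0 < 157 - 360 * a ^ 2 + 144 * a ^ 4 := by
    rw [ha4]; nlinarith [sq_nonneg (a ^ 2)]
  have hD2 : 0 < 6238 - 15015 * a ^ 2 + 6300 * a ^ 4 := by
    rw [ha4]; nlinarith [sq_nonneg (a ^ 2 - 1 / 2)]
  refine ⟨fun κ hκ₀ hκ₁ => ?_, ?_⟩
  · have h0 := memH0_shift ha₀ ha1 hκ₀ hκ₁
    refine ⟨h0, ?_, ?_⟩
    · rw [hTwo, Real.le_sqrt' hκ₀, le_div_iff₀ hD1, ← originForm_one_nonneg_iff ha1,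
        ← isKHyponormal_two_pairPow_iff ha₀ ha1 hκ₀ one_ne_zero, MemH, and_iff_right h0]
      simp [pairPow]
    · rw [hTwoPower, Real.le_sqrt' hκ₀, le_div_iff₀ hD2, ← originForm_two_nonneg_iff ha1,
        ← isKHyponormal_two_pairPow_iff ha₀ ha1 hκ₀ two_ne_zero, MemH,
        and_iff_right (h0.pairPow 2 1)]
  · refine Real.sqrt_lt_sqrt (div_nonneg (by linarith) hD1.le) ?_
    -- After cross-multiplication the cubic terms in `a²` cancel, leaving a quadratic in `a²` that
    -- is positive on `[0, 1/2]`.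
    rw [div_lt_div_iff₀ hD1 hD2, ha4]
    nlinarith [sq_nonneg (a ^ 2 - 1 / 2)]
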